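/- Let $V=(V,Y,\mathbf 1,T)$ be a vertex algebra over $\mathbb{C}$, with $Y(a,z)=\sum_{n\in\mathbb{Z}}a(n)z^{-n-1}$ and $[T,Y(a,z)]=\frac{\partial}{\partial z}Y(a,z)=Y(Ta,z)$. Suppose that $V$ is $\mathbb{C}$-graded, that is: (i) $V=\bigoplus_{\mu\in\mathbb{C}}V_\mu$, and $a(n)V_\mu\subseteq V_{\mu+\lambda-n-1}$ for all $a\in V_\lambda$ and $n\in\mathbb{Z}$; (ii) $V$ is generated, as a module over itself, by its lowest weight vectors, where a lowest weight vector is a homogeneous $v$ such that, for every $\lambda\in\mathbb{C}$, every $a\in V_\lambda$ and every $n\in\mathbb{Z}$, $a(n)v\neq 0$ implies $n=\lambda-1$ or $n<\mathrm{Re}(\lambda)-1$. For $a\in V_\mu$ put $|a|=\mu$ and $\widetilde{\mathrm{wt}}\,a=\lceil\mathrm{Re}\,\mu\rceil$, and for $r\in\mathbb{C}$ let $V^r$ be the sum of the $V_\mu$ with $\mu-\lceil\mathrm{Re}\,\mu\rceil=r$. Define bilinear products $\circ$ and $\star$ on $V$ by linear extension from homogeneous $a\in V^r$ (and arbitrary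 $b\in V$): $$a\circ b=\mathrm{Res}_z\,\frac{(1+z)^{\widetilde{\mathrm{wt}}\,a+\delta_{r,0}-1}}{z^{1+\delta_{r,0}}}\,Y(a,z)b,\qquad a\star b=\delta_{r,0}\,\mathrm{Res}_z\,\frac{(1+z)^{|a|}}{z}\,Y(a,z)b,$$ where $(1+z)^k$ is expanded in non-negative powers of $z$. (If $r=0$, then $|a|=\widetilde{\mathrm{wt}}\,a$ is an integer.) Let $O(V)$ be the linear span of all $a\circ b$ with $a,b\in V$, and let $A(V)=V/O(V)$. Then: (1) $V^r\subseteq O(V)$ for every $r\neq 0$; (2) $O(V)$ is a two-sided ideal for the star product: $a\star u\in O(V)$ and $u\star a\in O(V)$ for all $a\in V$ and $u\in O(V)$; (3) the star product induces a bilinear product on $A(V)$, and with it $A(V)$ is an associative algebra over $\mathbb{C}$, with identity element $\mathbf 1+O(V)$. -/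

import Mathlib

noncomputable section

/-- The `n`-th mode `a(n)` of a state `a` under a state-field correspondence `Y`, so that
`Y(a,z) = ∑ₙ a(n) z^{-n-1}`. -/
def stateMode {V : Type*} [AddCommGroup V] [Module ℂ V]
    (Y : V →ₗ[ℂ] VertexOperator ℂ V) (a : V) (n : ℤ) : Module.End ℂ V :=
  VertexOperator.ncoeff (Y a) n

/-- A vertex algebra structure `(V, Y, 𝟏, T)` on a complex vector space `V`.  The truncation
condition (`a(n)b = 0` for `n` large) is part of the type `VertexOperator`, so all the sums in the
Jacobi identity below have finite support. -/
structure VertexAlgebra (V : Type*) [AddCommGroup V] [Module ℂ V] where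
  /-- the state-field correspondence `a ↦ Y(a,z)` -/
  Y : V →ₗ[ℂ] VertexOperator ℂ V
  /-- the vacuum vector `𝟏` -/
  vac : V
  /-- the translation operator -/
  T : Module.End ℂ V
  /-- `Y(𝟏,z) = id` -/
  vac_mode : ∀ (n : ℤ) (b : V), stateMode Y vac n b = if n = -1 then b else 0
  /-- creation: `Y(a,z)𝟏` has no negative powers of `z` ... -/
  mode_vac : ∀ (a : V) (n : ℤ), 0 ≤ n → stateMode Y a n vac = 0
  /-- ... and constant term `a` -/
  mode_neg_one_vac : ∀ a : V, stateMode Y a (-1) vac = a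
  /-- `[T, Y(a,z)] = ∂_z Y(a,z)` -/
  T_comm : ∀ (a : V) (n : ℤ) (b : V),
    T (stateMode Y a n b) - stateMode Y a n (T b) = -(n : ℂ) • stateMode Y a (n - 1) b
  /-- `Y(Ta,z) = ∂_z Y(a,z)` -/
  T_mode : ∀ (a : V) (n : ℤ) (b : V),
    stateMode Y (T a) n b = -(n : ℂ) • stateMode Y a (n - 1) b
  /-- the Jacobi identity, written in modes -/
  jacobi : ∀ (a b c : V) (m n k : ℤ),
    ∑ᶠ i : ℕ, ((Ring.choose m i : ℤ) : ℂ) •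
        stateMode Y (stateMode Y a (k + i) b) (m + n - i) c =
      (∑ᶠ i : ℕ, ((-1 : ℂ) ^ i * ((Ring.choose k i : ℤ) : ℂ)) •
        stateMode Y a (m + k - i) (stateMode Y b (n + i) c)) -
      ∑ᶠ i : ℕ, ((-1 : ℂ) ^ i * (-1 : ℂ) ^ k * ((Ring.choose k i : ℤ) : ℂ)) •
        stateMode Y b (n + k - i) (stateMode Y a (m + i) c)

/-- `v` is a lowest weight vector for the grading `gr`: it is homogeneous, and `a(n)v ≠ 0` with
`a` of weight `l` forces `n = l - 1` or `n < Re l - 1`. -/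
def VertexAlgebra.IsLowestWeight {V : Type*} [AddCommGroup V] [Module ℂ V]
    (X : VertexAlgebra V) (gr : ℂ → Submodule ℂ V) (v : V) : Prop :=
  (∃ μ : ℂ, v ∈ gr μ) ∧
    ∀ (l : ℂ) (a : V) (n : ℤ), a ∈ gr l → stateMode X.Y a n v ≠ 0 →
      (n : ℂ) = l - 1 ∨ (n : ℝ) < l.re - 1

/-- A `ℂ`-graded vertex algebra structure on `V`. -/
structure CGradedVertexAlgebra (V : Type*) [AddCommGroup V] [Module ℂ V]
    extends VertexAlgebra V where
  /-- the homogeneous subspace `V_μ` -/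
  gr : ℂ → Submodule ℂ V
  /-- `V` is the direct sum of the `V_μ` -/
  isInternal : DirectSum.IsInternal gr
  /-- `a(n) V_μ ⊆ V_{μ + l - n - 1}` for `a ∈ V_l` -/
  mode_mem : ∀ (l μ : ℂ) (a b : V) (n : ℤ), a ∈ gr l → b ∈ gr μ →
    stateMode Y a n b ∈ gr (μ + l - n - 1)
  /-- `V` is generated, as a module over itself, by its lowest weight vectors -/
  generated : ∀ W : Submodule ℂ V,
    (∀ v, toVertexAlgebra.IsLowestWeight gr v → v ∈ W) →
    (∀ (a : V) (n : ℤ), ∀ w ∈ W, stateMode Y a n w ∈ W) → W = ⊤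

/-- The Laurent series `(1+z)^p / z^q` in `ℂ((z))`; for `p < 0` this is the expansion in
non-negative powers of `z`, divided by `z^q`. -/
def zhuKernel (p : ℤ) (q : ℕ) : LaurentSeries ℂ :=
  (1 + HahnSeries.single (1 : ℤ) (1 : ℂ)) ^ p / HahnSeries.single (1 : ℤ) (1 : ℂ) ^ q

theorem hahnModule_smul_smul {V : Type*} [AddCommGroup V] [Module ℂ V] (f : LaurentSeries ℂ)
    (r : ℂ) (x : HahnModule ℤ ℂ V) : f • (r • x) = r • (f • x) :=
  (smul_comm (M := ℂ) (N := HahnSeries ℤ ℂ) r f x).symm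

/-- `Res_z f(z) A(z) b`, the coefficient of `z⁻¹` in the product of `f(z) ∈ ℂ((z))` and
`A(z) b ∈ V((z))`; it is linear in `A` and in `b`. -/
def formalRes {V : Type*} [AddCommGroup V] [Module ℂ V] (f : LaurentSeries ℂ) :
    VertexOperator ℂ V →ₗ[ℂ] V →ₗ[ℂ] V :=
  LinearMap.mk₂ ℂ (fun A b => ((HahnModule.of ℂ).symm (f • A b)).coeff (-1))
    (fun A B b => by rw [LinearMap.add_apply, smul_add, HahnModule.of_symm_add]; rfl)
    (fun r A b => by rw [LinearMap.smul_apply, hahnModule_smul_smul]; rfl)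
    (fun A b c => by rw [map_add, smul_add, HahnModule.of_symm_add]; rfl)
    (fun r A b => by rw [LinearMap.map_smul, hahnModule_smul_smul]; rfl)

/-- For `a` of weight `μ`, the integer `⌈Re μ⌉`. -/
def ceilWt (μ : ℂ) : ℤ := ⌈μ.re⌉

/-- The index `r = μ - ⌈Re μ⌉` of the piece `V^r` that contains `V_μ`. -/
def fracWt (μ : ℂ) : ℂ := μ - ceilWt μ

/-- Kronecker's `δ_{r,0}`. -/
def kron (r : ℂ) : ℕ := if r = 0 then 1 else 0

namespace CGradedVertexAlgebra

variable {V : Type*} [AddCommGroup V] [Module ℂ V] (X : CGradedVertexAlgebra V)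

/-- The subspace `V^r`, the sum of the `V_μ` with `r = μ - ⌈Re μ⌉`. -/
def piece (r : ℂ) : Submodule ℂ V := ⨆ μ : {μ : ℂ // fracWt μ = r}, X.gr μ

/-- The isomorphism of `V` with the (external) direct sum of the `V_μ`. -/
def decomp : V ≃ₗ[ℂ] DirectSum ℂ fun μ => X.gr μ :=
  (LinearEquiv.ofBijective (DirectSum.coeLinearMap X.gr) X.isInternal).symm

/-- The linear extension to `V = ⨁ V_μ` of a family of bilinear products `φ μ`, where `φ μ` is
used for a left factor in `V_μ`. -/
def extendProd (φ : ℂ → V →ₗ[ℂ] V →ₗ[ℂ] V) : V →ₗ[ℂ] V →ₗ[ℂ] V :=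
  (DirectSum.toModule ℂ ℂ (V →ₗ[ℂ] V) fun μ => φ μ ∘ₗ (X.gr μ).subtype) ∘ₗ
    X.decomp.toLinearMap

theorem extendProd_of_mem (φ : ℂ → V →ₗ[ℂ] V →ₗ[ℂ] V) {μ : ℂ} {a : V} (ha : a ∈ X.gr μ) :
    X.extendProd φ a = φ μ a := by
  have h : X.decomp a = DirectSum.lof ℂ ℂ (fun μ => X.gr μ) μ ⟨a, ha⟩ :=
    (LinearEquiv.symm_apply_eq _).2 (DirectSum.coeLinearMap_lof X.gr μ ⟨a, ha⟩).symm
  rw [extendProd, LinearMap.comp_apply, LinearEquiv.coe_coe, h, DirectSum.toModule_lof]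
  rfl

/-- The circle product: for `a ∈ V_μ ⊆ V^r`,
`a ∘ b = Res_z (1+z)^{⌈Re μ⌉ + δ_{r,0} - 1} / z^{1 + δ_{r,0}} Y(a,z) b`. -/
def circ : V →ₗ[ℂ] V →ₗ[ℂ] V :=
  X.extendProd fun μ =>
    formalRes (zhuKernel (ceilWt μ + kron (fracWt μ) - 1) (1 + kron (fracWt μ))) ∘ₗ X.Y

/-- The star product: for `a ∈ V_μ ⊆ V^r`,
`a ⋆ b = δ_{r,0} Res_z (1+z)^{⌈Re μ⌉} / z Y(a,z) b`
(note `⌈Re μ⌉ = μ` when `r = 0`). -/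
def star : V →ₗ[ℂ] V →ₗ[ℂ] V :=
  X.extendProd fun μ => kron (fracWt μ) • (formalRes (zhuKernel (ceilWt μ) 1) ∘ₗ X.Y)

/-- `O(V)`, the linear span of all `a ∘ b`. -/
def O : Submodule ℂ V := Submodule.span ℂ {u | ∃ a b : V, u = X.circ a b}

/-- The quotient space `A(V) = V / O(V)`. -/
abbrev A : Type _ := V ⧸ X.O

end CGradedVertexAlgebra

end

/-!
Write `a_f = Res_z f(z) Y(a,z)` for `f ∈ ℂ((z))`; this is `VertexAlgebra.smear`. The proof uses only
two consequences of the Jacobi identity: the commutator formula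
`[a_f, b_g] = ∑ⱼ (a(j)b)_{f⁽ʲ⁾ g / j!}` (`VertexAlgebra.smear_commutator`), and skew-symmetry
(`VertexAlgebra.mode_skew`).

By integration by parts, `O(V)` contains `a_f b` for every `a ∈ V_μ`, `b ∈ V` and
`f ∈ (1+z)^{⌈Re μ⌉+δ-1} z^{-1-δ} ℂ[z⁻¹]`, where `δ` is `1` or `0` according as `μ` is an integer or
not (`smear_mem_O`). The `j`-th divided derivative of `(1+z)^e z^q P(z⁻¹)` is again of this
form with `e` replaced by `e - j`, while `a(j)b` has the weight of `a(0)b` lowered by `j`. Hence, if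
`a` has integral weight `l`, the commutator of `a_f` for `f ∈ (1+z)^{l-1} ℂ[z⁻¹]` with the operator
`b ∘ -` maps `V` into `O(V)`, and `a_f` preserves `O(V)` (`smear_mem_O_of_mem_O`). As
`(1+z)^l z⁻¹ = (1+z)^{l-1}(1+z⁻¹)`, this shows that `O(V)` is a left ideal.

Taking `b = 𝟏` in `a ∘ b` gives `V^r ⊆ O(V)` for `r ≠ 0` and `Ta ≡ -la` for `a ∈ V_l`, `l ∈ ℤ`.
Inserted into skew-symmetry, the latter shows that right multiplication `u ↦ u ⋆ c` by `c ∈ V_m`,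
`m ∈ ℤ`, is congruent modulo `O(V)` to `R_c = c_f` with `f = (1+z)^{m-1} z⁻¹`
(`star_sub_smear_mem_O`). This `f` also lies in `(1+z)^{m-1} ℂ[z⁻¹]`, so `O(V)` is a right ideal.
Associativity says that `R_c` commutes with `a ⋆ -` modulo `O(V)`, and this is once more the
commutator formula (`star_assoc_mem_O`).
-/

noncomputable section

/-! ### Laurent series -/

/-- The coefficientwise `ℂ`-algebra structure of `ℂ((z))`; it is given precedence over the one that
is transported from power series, which is not definitionally equal to it. -/
local instance coeffwiseAlgebra : Algebra ℂ (LaurentSeries ℂ) := HahnSeries.instAlgebra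

local instance coeffwise_isScalarTower : IsScalarTower ℂ (LaurentSeries ℂ) (LaurentSeries ℂ) :=
  ⟨fun r f g => Algebra.smul_mul_assoc r f g⟩

local instance coeffwise_smulCommClass : SMulCommClass ℂ (LaurentSeries ℂ) (LaurentSeries ℂ) :=
  ⟨fun r f g => (Algebra.mul_smul_comm r f g).symm⟩

/-- The variable `z` of `ℂ((z))`. -/
def zVar : LaurentSeries ℂ := HahnSeries.single (1 : ℤ) (1 : ℂ)

/-- The series `1 + z`. -/
def onePlusZ : LaurentSeries ℂ := 1 + zVar

theorem zhuKernel_eq (p : ℤ) (q : ℕ) : zhuKernel p q = onePlusZ ^ p * zVar ^ (-(q : ℤ)) := by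
  rw [zhuKernel, zpow_neg, zpow_natCast, div_eq_mul_inv]; rfl

theorem zVar_ne_zero : zVar ≠ 0 := by simp [zVar]

theorem zVar_zpow (n : ℤ) : zVar ^ n = HahnSeries.single n 1 := by
  have hn : ∀ n : ℕ, zVar ^ n = HahnSeries.single (n : ℤ) 1 := fun n => by
    simp [zVar, HahnSeries.single_pow]
  obtain ⟨m, rfl | rfl⟩ := n.eq_nat_or_neg
  · rw [zpow_natCast, hn]
  · rw [zpow_neg, zpow_natCast, hn]
    refine inv_eq_of_mul_eq_one_left ?_
    simp [HahnSeries.single_mul_single]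

theorem single_eq_smul (n : ℤ) (r : ℂ) :
    HahnSeries.single n r = r • HahnSeries.single n (1 : ℂ) := by
  rw [← HahnSeries.C_mul_eq_smul, HahnSeries.C_apply, HahnSeries.single_mul_single, zero_add,
    mul_one]

theorem onePlusZ_eq_coe :
    onePlusZ = ((1 + PowerSeries.X : PowerSeries ℂ) : LaurentSeries ℂ) := by
  rw [onePlusZ, PowerSeries.coe_add, PowerSeries.coe_one, PowerSeries.coe_X, zVar]

/-- Newton's binomial theorem with an integer exponent, in `ℂ((z))`. -/
theorem onePlusZ_zpow (p : ℤ) :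
    onePlusZ ^ p = ((PowerSeries.binomialSeries ℂ p : PowerSeries ℂ) : LaurentSeries ℂ) := by
  have hn : ∀ n : ℕ, onePlusZ ^ n =
      ((PowerSeries.binomialSeries ℂ (n : ℤ) : PowerSeries ℂ) : LaurentSeries ℂ) := fun n => by
    rw [PowerSeries.binomialSeries_nat, onePlusZ_eq_coe, PowerSeries.coe_pow]
  obtain ⟨m, rfl | rfl⟩ := p.eq_nat_or_neg
  · rw [zpow_natCast, hn]
  · rw [zpow_neg, zpow_natCast, hn]
    refine inv_eq_of_mul_eq_one_left ?_
    rw [← PowerSeries.coe_mul, ← PowerSeries.binomialSeries_add, neg_add_cancel,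
      PowerSeries.binomialSeries_zero, PowerSeries.coe_one]

theorem onePlusZ_ne_zero : onePlusZ ≠ 0 := by
  intro h
  have h1 : onePlusZ.coeff 0 = 1 := by simp [onePlusZ, zVar]
  rw [h] at h1
  simp at h1

theorem coeff_onePlusZ_zpow (p : ℤ) (n : ℕ) :
    (onePlusZ ^ p).coeff n = ((Ring.choose p n : ℤ) : ℂ) := by
  rw [onePlusZ_zpow, LaurentSeries.coeff_coe_powerSeries, PowerSeries.binomialSeries_coeff]
  simp

theorem coeff_onePlusZ_zpow_of_neg (p : ℤ) {n : ℤ} (hn : n < 0) :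
    (onePlusZ ^ p).coeff n = 0 := by
  rw [onePlusZ_zpow, PowerSeries.coeff_coe, if_pos hn]

theorem coeff_mul_zVar_zpow (f : LaurentSeries ℂ) (q n : ℤ) :
    (f * zVar ^ q).coeff n = f.coeff (n - q) := by
  have := HahnSeries.coeff_mul_single_add (r := (1 : ℂ)) (x := f) (a := n - q) (b := q)
  rw [zVar_zpow]
  simpa using this

theorem coeff_mul_eq_zero {f g : LaurentSeries ℂ} {U L n : ℤ} (hf : ∀ n < U, f.coeff n = 0)
    (hg : ∀ n < L, g.coeff n = 0) (hn : n < U + L) : (f * g).coeff n = 0 := by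
  rw [HahnSeries.coeff_mul]
  refine Finset.sum_eq_zero fun ij hij => ?_
  rw [Finset.mem_antidiagonal] at hij
  by_cases h : ij.1 < U
  · rw [hf _ h, zero_mul]
  · rw [hg _ (by lia), mul_zero]

theorem exists_coeff_eq_zero_of_lt (f : LaurentSeries ℂ) : ∃ L : ℤ, ∀ n < L, f.coeff n = 0 :=
  ⟨f.order, fun _ h => HahnSeries.coeff_eq_zero_of_lt_order h⟩

/-! ### Continuous linear maps on Laurent series -/

/-- Continuity, for the `z`-adic topology on `ℂ((z))` and the discrete topology on `W`, of a
linear map: it annihilates `z^U ℂ[[z]]` for some `U`. -/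
def ZAdicContinuous {W : Type*} [AddCommGroup W] [Module ℂ W] (φ : LaurentSeries ℂ →ₗ[ℂ] W) :
    Prop :=
  ∃ U : ℤ, ∀ f : LaurentSeries ℂ, (∀ n < U, f.coeff n = 0) → φ f = 0

namespace ZAdicContinuous

variable {W W' : Type*} [AddCommGroup W] [Module ℂ W] [AddCommGroup W'] [Module ℂ W']

theorem sub {φ ψ : LaurentSeries ℂ →ₗ[ℂ] W} (hφ : ZAdicContinuous φ) (hψ : ZAdicContinuous ψ) :
    ZAdicContinuous (φ - ψ) := by
  obtain ⟨U, hU⟩ := hφ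
  obtain ⟨U', hU'⟩ := hψ
  refine ⟨max U U', fun f hf => ?_⟩
  rw [LinearMap.sub_apply, hU f fun n hn => hf n (lt_max_of_lt_left hn),
    hU' f fun n hn => hf n (lt_max_of_lt_right hn), sub_zero]

theorem neg {φ : LaurentSeries ℂ →ₗ[ℂ] W} (hφ : ZAdicContinuous φ) : ZAdicContinuous (-φ) := by
  obtain ⟨U, hU⟩ := hφ
  exact ⟨U, fun f hf => by rw [LinearMap.neg_apply, hU f hf, neg_zero]⟩

theorem sum {ι : Type*} (s : Finset ι) {φ : ι → LaurentSeries ℂ →ₗ[ℂ] W}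
    (hφ : ∀ i, ZAdicContinuous (φ i)) : ZAdicContinuous (∑ i ∈ s, φ i) := by
  choose U hU using hφ
  obtain ⟨M, hM⟩ := (s.image U).bddAbove
  refine ⟨M, fun f hf => ?_⟩
  rw [LinearMap.sum_apply]
  exact Finset.sum_eq_zero fun i hi =>
    hU i f fun n hn => hf n (hn.trans_le (hM (by simpa using ⟨i, hi, rfl⟩)))

theorem comp_left {φ : LaurentSeries ℂ →ₗ[ℂ] W} (hφ : ZAdicContinuous φ) (l : W →ₗ[ℂ] W') :
    ZAdicContinuous (l ∘ₗ φ) := by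
  obtain ⟨U, hU⟩ := hφ
  exact ⟨U, fun f hf => by rw [LinearMap.comp_apply, hU f hf, map_zero]⟩

theorem comp_mulRight {φ : LaurentSeries ℂ →ₗ[ℂ] W} (hφ : ZAdicContinuous φ)
    (g : LaurentSeries ℂ) : ZAdicContinuous (φ ∘ₗ LinearMap.mulRight ℂ g) := by
  obtain ⟨U, hU⟩ := hφ
  obtain ⟨L, hL⟩ := exists_coeff_eq_zero_of_lt g
  exact ⟨U - L, fun f hf => hU _ fun n hn =>
    coeff_mul_eq_zero hf hL (by rwa [sub_add_cancel])⟩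

theorem comp_hasseDeriv {φ : LaurentSeries ℂ →ₗ[ℂ] W} (hφ : ZAdicContinuous φ) (j : ℕ) :
    ZAdicContinuous (φ ∘ₗ LaurentSeries.hasseDeriv ℂ j) := by
  obtain ⟨U, hU⟩ := hφ
  refine ⟨U + j, fun f hf => hU _ fun n hn => ?_⟩
  rw [LaurentSeries.hasseDeriv_coeff, hf _ (by lia), smul_zero]

/-- Continuous linear maps on `ℂ((z))` are determined by their values on the powers of `z`. -/
theorem ext {φ ψ : LaurentSeries ℂ →ₗ[ℂ] W} (hφ : ZAdicContinuous φ) (hψ : ZAdicContinuous ψ)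
    (h : ∀ n : ℤ, φ (HahnSeries.single n 1) = ψ (HahnSeries.single n 1)) : φ = ψ := by
  obtain ⟨U, hU⟩ := hφ.sub hψ
  ext f
  obtain ⟨L, hL⟩ := exists_coeff_eq_zero_of_lt f
  rw [← sub_eq_zero, ← LinearMap.sub_apply]
  have key : ∀ n : ℤ, (∑ m ∈ Finset.Ico L U, HahnSeries.single m (f.coeff m)).coeff n =
      if L ≤ n ∧ n < U then f.coeff n else 0 := fun n => by
    rw [HahnSeries.coeff_sum]
    by_cases hn : L ≤ n ∧ n < U
    · rw [if_pos hn, Finset.sum_eq_single_of_mem n (Finset.mem_Ico.2 hn) fun m _ hm =>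
        HahnSeries.coeff_single_of_ne hm.symm, HahnSeries.coeff_single_same]
    · rw [if_neg hn]
      exact Finset.sum_eq_zero fun m hm => HahnSeries.coeff_single_of_ne fun h =>
        hn (h ▸ Finset.mem_Ico.1 hm)
  have h1 : (φ - ψ) (∑ m ∈ Finset.Ico L U, HahnSeries.single m (f.coeff m)) = 0 := by
    rw [map_sum]
    refine Finset.sum_eq_zero fun m _ => ?_
    rw [single_eq_smul, map_smul, LinearMap.sub_apply, h, sub_self, smul_zero]
  have h2 := hU (f - ∑ m ∈ Finset.Ico L U, HahnSeries.single m (f.coeff m)) fun n hn => by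
    rw [HahnSeries.coeff_sub, key]
    split_ifs with hc
    · exact sub_self _
    · rw [hL n (by lia), sub_zero]
  rwa [map_sub, h1, sub_zero] at h2

end ZAdicContinuous

theorem zAdicContinuous_coeff (N : ℤ) : ZAdicContinuous (⟨⟨fun f => f.coeff N, fun _ _ => rfl⟩,
    fun _ _ => rfl⟩ : LaurentSeries ℂ →ₗ[ℂ] ℂ) :=
  ⟨N + 1, fun _ hf => hf N (by lia)⟩

/-! ### Differentiation and the spaces `(1+z)^e z^q ℂ[z⁻¹]` -/

/-- `d/dz` as a derivation of `ℂ((z))`. -/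
def zDeriv : Derivation ℂ (LaurentSeries ℂ) (LaurentSeries ℂ) :=
  Derivation.mk' (LaurentSeries.derivative ℂ) fun f g => by
    -- The Leibniz rule for each coefficient is continuous in `f` and in `g`.
    ext N
    set c : LaurentSeries ℂ →ₗ[ℂ] ℂ := ⟨⟨fun f => f.coeff N, fun _ _ => rfl⟩, fun _ _ => rfl⟩
    have hc : ZAdicContinuous c := zAdicContinuous_coeff N
    have hd (h : LaurentSeries ℂ) : ZAdicContinuous (c ∘ₗ LaurentSeries.derivative ℂ ∘ₗ
        LinearMap.mulRight ℂ h) := (hc.comp_hasseDeriv 1).comp_mulRight h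
    have hr (h : LaurentSeries ℂ) : ZAdicContinuous (c ∘ₗ LinearMap.mulRight ℂ h) :=
      hc.comp_mulRight h
    have hl (h : LaurentSeries ℂ) : ZAdicContinuous (c ∘ₗ LinearMap.mulRight ℂ h ∘ₗ
        LaurentSeries.derivative ℂ) := (hr h).comp_hasseDeriv 1
    have e : ∀ f g : LaurentSeries ℂ, c (LaurentSeries.derivative ℂ (f * g)) -
        c (f * LaurentSeries.derivative ℂ g) = c (LaurentSeries.derivative ℂ f * g) := by
      intro f g
      refine LinearMap.congr_fun (ZAdicContinuous.ext ((hd g).sub (hr _)) (hl g) fun m => ?_) f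
      change c (LaurentSeries.derivative ℂ (_ * g)) - c (_ * LaurentSeries.derivative ℂ g) =
        c (LaurentSeries.derivative ℂ _ * g)
      rw [mul_comm _ g, mul_comm _ (LaurentSeries.derivative ℂ g), mul_comm _ g]
      refine LinearMap.congr_fun (ZAdicContinuous.ext ((hd _).sub (hl _)) (hr _) fun n => ?_) g
      change c (LaurentSeries.derivative ℂ _) - c (LaurentSeries.derivative ℂ _ * _) =
        c (_ * LaurentSeries.derivative ℂ _)
      rw [← map_sub]
      congr 1
      simp only [LaurentSeries.derivative_apply, LinearMap.mulRight_apply,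
        HahnSeries.single_mul_single, LaurentSeries.hasseDeriv_single, Nat.cast_one,
        Ring.choose_one_right, zsmul_eq_mul]
      rw [show n - 1 + m = n + m - 1 by ring, show n + (m - 1) = n + m - 1 by ring,
        ← HahnSeries.single_sub]
      congr 1
      push_cast
      ring
    have := e f g
    rw [sub_eq_iff_eq_add] at this
    refine this.trans ?_
    rw [add_comm, smul_eq_mul, smul_eq_mul, mul_comm g]
    rfl

theorem zDeriv_apply (f : LaurentSeries ℂ) : zDeriv f = LaurentSeries.derivative ℂ f := rfl

theorem zDeriv_zVar : zDeriv zVar = 1 := by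
  rw [zDeriv_apply, zVar, LaurentSeries.derivative_apply, LaurentSeries.hasseDeriv_single]
  simp

theorem zDeriv_onePlusZ : zDeriv onePlusZ = 1 := by
  rw [onePlusZ, map_add, zDeriv_zVar, Derivation.map_one_eq_zero, zero_add]

/-- The algebra `ℂ[z⁻¹]` of polynomials in `z⁻¹`. -/
def invZPoly : Subalgebra ℂ (LaurentSeries ℂ) := Algebra.adjoin ℂ {zVar⁻¹}

theorem inv_zVar_mem : zVar⁻¹ ∈ invZPoly := Algebra.subset_adjoin rfl

theorem onePlusZ_mul_inv : onePlusZ * zVar⁻¹ = zVar⁻¹ + 1 := by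
  rw [onePlusZ, add_mul, one_mul, mul_inv_cancel₀ zVar_ne_zero]

theorem onePlusZ_mul_inv_mem : onePlusZ * zVar⁻¹ ∈ invZPoly :=
  onePlusZ_mul_inv ▸ add_mem inv_zVar_mem (one_mem _)

theorem onePlusZ_mul_zDeriv_mem {β : LaurentSeries ℂ} (hβ : β ∈ invZPoly) :
    onePlusZ * zDeriv β ∈ invZPoly := by
  induction hβ using Algebra.adjoin_induction with
  | mem x hx =>
    obtain rfl : x = zVar⁻¹ := hx
    rw [← zpow_neg_one, Derivation.leibniz_zpow, zDeriv_zVar]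
    have : onePlusZ * ((-1 : ℤ) • zVar ^ (-1 - 1 : ℤ) • (1 : LaurentSeries ℂ)) =
        -(onePlusZ * zVar⁻¹ * zVar⁻¹) := by
      rw [zpow_sub_one₀ zVar_ne_zero, zpow_neg_one]
      simp only [smul_eq_mul, mul_one, zsmul_eq_mul, Int.cast_neg, Int.cast_one]
      ring
    rw [this]
    exact neg_mem (mul_mem onePlusZ_mul_inv_mem inv_zVar_mem)
  | algebraMap r => simp
  | add x y _ _ hx hy => rw [map_add, mul_add]; exact add_mem hx hy
  | mul x y hx' hy' hx hy =>
    rw [Derivation.leibniz, mul_add, smul_eq_mul, smul_eq_mul, mul_left_comm, mul_left_comm _ y]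
    exact add_mem (mul_mem hx' hy) (mul_mem hy' hx)

/-- The space `(1+z)^e z^q ℂ[z⁻¹]`. -/
def kernelSpace (e q : ℤ) : Submodule ℂ (LaurentSeries ℂ) :=
  (Subalgebra.toSubmodule invZPoly).map (LinearMap.mulLeft ℂ (onePlusZ ^ e * zVar ^ q))

theorem mem_kernelSpace {e q : ℤ} {f : LaurentSeries ℂ} :
    f ∈ kernelSpace e q ↔ ∃ β ∈ invZPoly, onePlusZ ^ e * zVar ^ q * β = f := Iff.rfl

theorem zDeriv_mem_kernelSpace {e q : ℤ} {f : LaurentSeries ℂ} (hf : f ∈ kernelSpace e q) :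
    zDeriv f ∈ kernelSpace (e - 1) q := by
  obtain ⟨β, hβ, rfl⟩ := mem_kernelSpace.1 hf
  refine mem_kernelSpace.2 ⟨(e : ℂ) • β + (q : ℂ) • (onePlusZ * zVar⁻¹ * β) + onePlusZ * zDeriv β,
    add_mem (add_mem (Subalgebra.smul_mem _ hβ _)
      (Subalgebra.smul_mem _ (mul_mem onePlusZ_mul_inv_mem hβ) _)) (onePlusZ_mul_zDeriv_mem hβ), ?_⟩
  rw [Derivation.leibniz, Derivation.leibniz, Derivation.leibniz_zpow, Derivation.leibniz_zpow,
    zDeriv_zVar, zDeriv_onePlusZ, zpow_sub_one₀ zVar_ne_zero, zpow_sub_one₀ onePlusZ_ne_zero]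
  simp only [smul_eq_mul, mul_one, ← HahnSeries.C_mul_eq_smul, zsmul_eq_mul, map_intCast]
  have := onePlusZ_ne_zero
  field_simp
  ring

theorem hasseDeriv_mem_kernelSpace {e q : ℤ} {f : LaurentSeries ℂ} (hf : f ∈ kernelSpace e q)
    (j : ℕ) : LaurentSeries.hasseDeriv ℂ j f ∈ kernelSpace (e - j) q := by
  have h : ∀ j : ℕ, (LaurentSeries.derivative ℂ)^[j] f ∈ kernelSpace (e - j) q := fun j => by
    induction j with
    | zero => simpa using hf
    | succ j ih =>
      rw [Function.iterate_succ_apply', Nat.cast_succ, ← sub_sub]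
      exact zDeriv_mem_kernelSpace ih
  have h2 := h j
  rw [LaurentSeries.derivative_iterate, ← Nat.cast_smul_eq_nsmul ℂ] at h2
  exact (Submodule.smul_mem_iff _ (Nat.cast_ne_zero.2 j.factorial_ne_zero)).1 h2

theorem mul_mem_kernelSpace {e q e' q' : ℤ} {f g : LaurentSeries ℂ} (hf : f ∈ kernelSpace e q)
    (hg : g ∈ kernelSpace e' q') : f * g ∈ kernelSpace (e + e') (q + q') := by
  obtain ⟨β, hβ, rfl⟩ := mem_kernelSpace.1 hf
  obtain ⟨γ, hγ, rfl⟩ := mem_kernelSpace.1 hg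
  refine mem_kernelSpace.2 ⟨β * γ, mul_mem hβ hγ, ?_⟩
  rw [zpow_add₀ onePlusZ_ne_zero, zpow_add₀ zVar_ne_zero]
  ring

theorem monomial_mem_kernelSpace (e q : ℤ) : onePlusZ ^ e * zVar ^ q ∈ kernelSpace e q :=
  mem_kernelSpace.2 ⟨1, one_mem _, mul_one _⟩

/-- `(1+z)^{e+1} z^{q-1} = (1+z)^e z^q (1 + z⁻¹)`. -/
theorem kernelSpace_succ_pred_le (e q : ℤ) : kernelSpace (e + 1) (q - 1) ≤ kernelSpace e q := by
  intro f hf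
  obtain ⟨β, hβ, rfl⟩ := mem_kernelSpace.1 hf
  refine mem_kernelSpace.2 ⟨onePlusZ * zVar⁻¹ * β, mul_mem onePlusZ_mul_inv_mem hβ, ?_⟩
  rw [zpow_add_one₀ onePlusZ_ne_zero, zpow_sub_one₀ zVar_ne_zero]
  ring

theorem kernelSpace_pred_le (e q : ℤ) : kernelSpace e (q - 1) ≤ kernelSpace e q := by
  intro f hf
  obtain ⟨β, hβ, rfl⟩ := mem_kernelSpace.1 hf
  refine mem_kernelSpace.2 ⟨zVar⁻¹ * β, mul_mem inv_zVar_mem hβ, ?_⟩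
  rw [zpow_sub_one₀ zVar_ne_zero]
  ring

/-- A submodule contains `(1+z)^e z^q ℂ[z⁻¹]` as soon as it contains all `(1+z)^e z^{q-n}`. -/
theorem kernelSpace_le_of_monomials {e q : ℤ} {S : Submodule ℂ (LaurentSeries ℂ)}
    (h : ∀ n : ℕ, onePlusZ ^ e * zVar ^ (q - n) ∈ S) : kernelSpace e q ≤ S := by
  intro f hf
  obtain ⟨β, hβ, rfl⟩ := mem_kernelSpace.1 hf
  rw [invZPoly, Algebra.adjoin_singleton_eq_range_aeval] at hβ
  obtain ⟨P, rfl⟩ := hβ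
  change _ * Polynomial.aeval zVar⁻¹ P ∈ S
  rw [Polynomial.aeval_eq_sum_range, Finset.mul_sum]
  refine Submodule.sum_mem _ fun n _ => ?_
  rw [mul_smul_comm, inv_pow, ← zpow_natCast, ← zpow_neg, mul_assoc, ← zpow_add₀ zVar_ne_zero]
  exact S.smul_mem _ (h n)

/-! ### Smeared fields -/

namespace VertexAlgebra

variable {V : Type*} [AddCommGroup V] [Module ℂ V] (X : VertexAlgebra V)

/-- The mode `a(n)` of the vertex algebra `X`. -/
abbrev mode (a : V) (n : ℤ) : Module.End ℂ V := stateMode X.Y a n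

/-- `X.smear f a b = Res_z f(z) Y(a,z) b`, as a trilinear map. -/
def smear : LaurentSeries ℂ →ₗ[ℂ] V →ₗ[ℂ] V →ₗ[ℂ] V :=
  LinearMap.mk₂ ℂ (fun f a => formalRes f (X.Y a))
    (fun f g a => by
      ext b
      change ((HahnModule.of ℂ).symm ((f + g) • X.Y a b)).coeff (-1) = _
      rw [HahnModule.add_smul fun r s v => add_smul r s v, HahnModule.of_symm_add]
      rfl)
    (fun r f a => by
      ext b
      change ((HahnModule.of ℂ).symm ((r • f) • X.Y a b)).coeff (-1) = _
      rw [smul_assoc (M := ℂ) (N := HahnSeries ℤ ℂ) r f (X.Y a b)]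
      rfl)
    (fun f a b => by rw [map_add, map_add])
    (fun r f a => by rw [map_smul, map_smul])

theorem smear_single (n : ℤ) (a b : V) :
    X.smear (HahnSeries.single n 1) a b = X.mode a n b := by
  have := HahnModule.coeff_single_smul_vadd (r := (1 : ℂ)) (x := X.Y a b) (a := -n - 1) (b := n)
  rw [one_smul, vadd_eq_add, show n + (-n - 1) = -1 by ring] at this
  exact this

theorem exists_mode_eq_zero (a b : V) : ∃ U : ℤ, ∀ n, U ≤ n → X.mode a n b = 0 :=
  ⟨-((HahnModule.of ℂ).symm (X.Y a b)).order, fun n hn =>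
    VertexOperator.ncoeff_eq_zero_of_lt_order _ _ _ (by lia)⟩

theorem exists_mode_eq_zero_nat (a b : V) : ∃ J : ℕ, ∀ n : ℤ, J ≤ n → X.mode a n b = 0 := by
  obtain ⟨U, hU⟩ := X.exists_mode_eq_zero a b
  exact ⟨U.toNat, fun n hn => hU n (by lia)⟩

theorem smear_eq_zero {f : LaurentSeries ℂ} {a b : V} {U : ℤ}
    (hU : ∀ n, U ≤ n → X.mode a n b = 0) (hf : ∀ n < U, f.coeff n = 0) : X.smear f a b = 0 := by
  change ((HahnModule.of ℂ).symm (f • X.Y a b)).coeff (-1) = 0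
  rw [HahnModule.coeff_smul]
  refine Finset.sum_eq_zero fun ij hij => ?_
  have h : ij.1 + ij.2 = -1 := ((Finset.mem_vaddAntidiagonal _ _).1 hij).2.2
  by_cases h1 : ij.1 < U
  · rw [hf _ h1, zero_smul]
  · have h2 := hU ij.1 (by lia)
    have h3 : ij.2 = -ij.1 - 1 := by lia
    rw [h3]
    exact (congrArg _ h2).trans (smul_zero _)

/-- `f ↦ Res_z f(z) Y(a,z) b` as a linear map on `ℂ((z))`. -/
def smearFun (a b : V) : LaurentSeries ℂ →ₗ[ℂ] V := (X.smear.flip a).flip b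

theorem smearFun_apply (f : LaurentSeries ℂ) (a b : V) : X.smearFun a b f = X.smear f a b := rfl

theorem zAdicContinuous_smearFun (a b : V) : ZAdicContinuous (X.smearFun a b) := by
  obtain ⟨U, hU⟩ := X.exists_mode_eq_zero a b
  exact ⟨U, fun f hf => X.smear_eq_zero hU hf⟩

/-- The commutator formula for modes. -/
theorem mode_commutator (a b c : V) (m n : ℤ) {J : ℕ} (hJ : ∀ n : ℤ, J ≤ n → X.mode a n b = 0) :
    X.mode a m (X.mode b n c) - X.mode b n (X.mode a m c) =
      ∑ j ∈ Finset.range J, ((Ring.choose m j : ℤ) : ℂ) • X.mode (X.mode a j b) (m + n - j) c := by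
  -- For `k = 0` only the terms with `i = 0` survive on the right-hand side.
  have h := X.jacobi a b c m n 0
  rw [finsum_eq_sum_of_support_subset (s := Finset.range J), finsum_eq_single _ 0,
    finsum_eq_single _ 0] at h
  · simpa using h.symm
  · intro i hi
    simp [Ring.choose_zero_pos ℤ (Nat.pos_of_ne_zero hi)]
  · intro i hi
    simp [Ring.choose_zero_pos ℤ (Nat.pos_of_ne_zero hi)]
  · intro i hi
    simp only [Finset.coe_range, Set.mem_Iio]
    by_contra hc
    refine hi ?_
    have := hJ (0 + i) (by lia)
    change _ • stateMode X.Y (stateMode X.Y a (0 + i) b) _ c = 0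
    rw [this]
    simp [stateMode]

/-- The commutator formula
`[a_f, b_g] = ∑ⱼ (a(j)b)_{f⁽ʲ⁾ g / j!}`, where `a_f = Res_z f(z) Y(a,z)`. -/
theorem smear_commutator (f g : LaurentSeries ℂ) (a b c : V) {J : ℕ}
    (hJ : ∀ n : ℤ, J ≤ n → X.mode a n b = 0) :
    X.smear f a (X.smear g b c) - X.smear g b (X.smear f a c) =
      ∑ j ∈ Finset.range J, X.smear (LaurentSeries.hasseDeriv ℂ j f * g) (X.mode a j b) c := by
  have hf := ZAdicContinuous.ext
    (φ := X.smearFun a (X.smear g b c) - X.smear g b ∘ₗ X.smearFun a c)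
    (ψ := ∑ j ∈ Finset.range J, (X.smearFun (X.mode a j b) c ∘ₗ LinearMap.mulRight ℂ g) ∘ₗ
      LaurentSeries.hasseDeriv ℂ j)
    ((X.zAdicContinuous_smearFun _ _).sub ((X.zAdicContinuous_smearFun _ _).comp_left _))
    (ZAdicContinuous.sum _ fun j =>
      ((X.zAdicContinuous_smearFun _ _).comp_mulRight g).comp_hasseDeriv j) fun m => ?_
  · have := LinearMap.congr_fun hf f
    rw [LinearMap.sum_apply] at this
    exact this
  have hg := ZAdicContinuous.ext
    (φ := X.mode a m ∘ₗ X.smearFun b c - X.smearFun b (X.mode a m c))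
    (ψ := ∑ j ∈ Finset.range J, X.smearFun (X.mode a j b) c ∘ₗ LinearMap.mulRight ℂ
      (LaurentSeries.hasseDeriv ℂ j (HahnSeries.single m (1 : ℂ))))
    (((X.zAdicContinuous_smearFun _ _).comp_left _).sub (X.zAdicContinuous_smearFun _ _))
    (ZAdicContinuous.sum _ fun j => (X.zAdicContinuous_smearFun _ _).comp_mulRight _) fun n => ?_
  · have := LinearMap.congr_fun hg g
    simp only [LinearMap.sum_apply, LinearMap.sub_apply, LinearMap.comp_apply, smearFun_apply,
      LinearMap.mulRight_apply, smear_single] at this ⊢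
    rw [this]
    exact Finset.sum_congr rfl fun j _ => by rw [mul_comm]
  simp only [LinearMap.sum_apply, LinearMap.sub_apply, LinearMap.comp_apply, smearFun_apply,
    LinearMap.mulRight_apply, smear_single]
  rw [X.mode_commutator a b c m n hJ]
  refine Finset.sum_congr rfl fun j _ => ?_
  rw [LaurentSeries.hasseDeriv_single, HahnSeries.single_mul_single, one_mul,
    show n + (m - j) = m + n - j by ring, ← X.smear_single, zsmul_one]
  rw [single_eq_smul _ ((Ring.choose m j : ℤ) : ℂ), map_smul]
  rfl

/-- `Y(Ta,z) = ∂_z Y(a,z)`, integrated by parts. -/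
theorem smear_T (f : LaurentSeries ℂ) (a b : V) :
    X.smear f (X.T a) b = -X.smear (zDeriv f) a b := by
  refine LinearMap.congr_fun (ZAdicContinuous.ext (φ := X.smearFun (X.T a) b)
    (ψ := -(X.smearFun a b ∘ₗ LaurentSeries.hasseDeriv ℂ 1)) (X.zAdicContinuous_smearFun _ _)
    ((X.zAdicContinuous_smearFun _ _).comp_hasseDeriv 1).neg fun n => ?_) f
  rw [LinearMap.neg_apply, LinearMap.comp_apply, smearFun_apply, smearFun_apply, smear_single,
    LaurentSeries.hasseDeriv_single, Nat.cast_one, Ring.choose_one_right, zsmul_one]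
  rw [single_eq_smul, map_smul, LinearMap.smul_apply, LinearMap.smul_apply, smear_single,
    ← neg_smul]
  exact X.T_mode a n b

theorem T_eq (a : V) : X.T a = X.mode a (-2) X.vac := by
  have := X.T_mode a (-1) X.vac
  rw [X.mode_neg_one_vac] at this
  simpa using this

/-- `a(-1-i)𝟏 = Tⁱa / i!`. -/
theorem factorial_smul_mode_vac (a : V) (i : ℕ) :
    (i.factorial : ℂ) • X.mode a (-1 - i) X.vac = (X.T ^ i) a := by
  induction i generalizing a with
  | zero => simpa using X.mode_neg_one_vac a
  | succ i ih =>
    rw [pow_succ, Module.End.mul_apply, ← ih, X.T_mode a, smul_smul]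
    rw [Nat.factorial_succ]
    push_cast
    congr 1
    · ring
    · rw [show (-1 - (i : ℤ) - 1) = -1 - (i + 1) by ring]

/-- Skew-symmetry: `Y(a,z)u = e^{zT} Y(u,-z)a`, in modes. -/
theorem mode_skew (a u : V) (k : ℤ) {J : ℕ} (hJ : ∀ i : ℤ, J ≤ i → X.mode u (k + i) a = 0) :
    X.mode a k u = (-1 : ℂ) ^ (k + 1) •
      ∑ i ∈ Finset.range J, (-1 : ℂ) ^ i • X.mode (X.mode u (k + i) a) (-1 - i) X.vac := by
  -- With third vector `𝟏`, creation leaves only the term `i = 0` of the last sum, `a(k)u(-1)𝟏`.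
  have h := X.jacobi u a X.vac (-1) 0 k
  have h1 : ∀ i : ℕ, stateMode X.Y a (0 + i) X.vac = 0 := fun i => X.mode_vac a _ (by lia)
  have hc : ∀ i : ℕ, Ring.choose (-1 : ℤ) i = (-1) ^ i := fun i => by
    rw [Ring.choose_neg]
    rw [show (1 : ℤ) + i - 1 = i by ring, Ring.choose_natCast, Nat.choose_self]
    simp [Int.negOnePow_def, Units.smul_def]
  rw [finsum_eq_sum_of_support_subset (s := Finset.range J), finsum_eq_zero_of_forall_eq_zero,
    finsum_eq_single _ 0] at h
  · simp only [hc] at h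
    push_cast at h
    have hs : ∑ i ∈ Finset.range J, (-1 : ℂ) ^ i • X.mode (X.mode u (k + i) a) (-1 - i) X.vac =
        -((-1 : ℂ) ^ k • X.mode a k u) := by
      simpa [mode_neg_one_vac, sub_eq_add_neg] using h
    rw [hs, ← smul_neg, smul_smul, zpow_add_one₀ (by norm_num), mul_neg_one, neg_mul,
      ← mul_zpow, neg_one_mul, neg_neg, one_zpow, neg_one_smul, neg_neg]
  · intro i hi
    have : stateMode X.Y u (-1 + i) X.vac = 0 := X.mode_vac u _ (by lia)
    rw [this, map_zero, smul_zero]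
  · intro i
    rw [h1, map_zero, smul_zero]
  · intro i hi
    simp only [Finset.coe_range, Set.mem_Iio]
    by_contra hc
    refine hi ?_
    have := hJ i (by lia)
    change _ • stateMode X.Y (stateMode X.Y u (k + i) a) _ X.vac = 0
    rw [this]
    simp [stateMode]

end VertexAlgebra

namespace VertexAlgebra

variable {V : Type*} [AddCommGroup V] [Module ℂ V] (X : VertexAlgebra V)

/-- `Res_z (1+z)^e z⁻¹ Y(a,z) b = ∑ⱼ (e choose j) a(j-1)b`. -/
theorem smear_eq_sum (e : ℤ) (a b : V) {J : ℕ} (hJ : ∀ n : ℤ, (J : ℤ) - 1 ≤ n → X.mode a n b = 0) :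
    X.smear (onePlusZ ^ e * zVar ^ (-1 : ℤ)) a b =
      ∑ j ∈ Finset.range J, ((Ring.choose e j : ℤ) : ℂ) • X.mode a ((j : ℤ) - 1) b := by
  have hs : X.smear (∑ j ∈ Finset.range J, ((Ring.choose e j : ℤ) : ℂ) •
      HahnSeries.single ((j : ℤ) - 1) (1 : ℂ)) a b =
      ∑ j ∈ Finset.range J, ((Ring.choose e j : ℤ) : ℂ) • X.mode a ((j : ℤ) - 1) b := by
    rw [← smearFun_apply, map_sum]
    exact Finset.sum_congr rfl fun j _ => by rw [map_smul, smearFun_apply, smear_single]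
  rw [← hs, ← sub_eq_zero, ← smearFun_apply, ← smearFun_apply, ← map_sub, smearFun_apply]
  refine X.smear_eq_zero hJ fun n hn => ?_
  rw [HahnSeries.coeff_sub, coeff_mul_zVar_zpow, HahnSeries.coeff_sum, sub_neg_eq_add,
    sub_eq_zero]
  by_cases h : n + 1 < 0
  · rw [coeff_onePlusZ_zpow_of_neg _ h]
    refine (Finset.sum_eq_zero fun j _ => ?_).symm
    rw [HahnSeries.coeff_smul, HahnSeries.coeff_single_of_ne (by lia), smul_zero]
  · obtain ⟨k, hk⟩ := Int.eq_ofNat_of_zero_le (not_lt.1 h)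
    rw [hk, coeff_onePlusZ_zpow, Finset.sum_eq_single_of_mem k (Finset.mem_range.2 (by lia))]
    · rw [HahnSeries.coeff_smul, show n = (k : ℤ) - 1 by lia, HahnSeries.coeff_single_same,
        smul_eq_mul, mul_one]
    · intro j _ hj
      rw [HahnSeries.coeff_smul, HahnSeries.coeff_single_of_ne (by lia), smul_zero]

theorem smear_vac (e : ℤ) (a : V) :
    X.smear (onePlusZ ^ e * zVar ^ (-1 : ℤ)) a X.vac = a := by
  rw [X.smear_eq_sum e a X.vac (J := 1) fun n hn => X.mode_vac a n (by simpa using hn)]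
  simp [X.mode_neg_one_vac]

/-- `Res_z (1+z)^e z⁻² Y(a,z)𝟏 = Ta + ea`. -/
theorem smear_vac' (e : ℤ) (a : V) :
    X.smear (onePlusZ ^ e * zVar ^ (-2 : ℤ)) a X.vac = X.T a + (e : ℂ) • a := by
  have h := X.smear_T (onePlusZ ^ e * zVar ^ (-1 : ℤ)) a X.vac
  have hd : zDeriv (onePlusZ ^ e * zVar ^ (-1 : ℤ)) =
      (e : ℂ) • (onePlusZ ^ (e - 1) * zVar ^ (-1 : ℤ)) - onePlusZ ^ e * zVar ^ (-2 : ℤ) := by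
    rw [Derivation.leibniz, Derivation.leibniz_zpow, Derivation.leibniz_zpow, zDeriv_zVar,
      zDeriv_onePlusZ]
    simp only [smul_eq_mul, mul_one, ← HahnSeries.C_mul_eq_smul, zsmul_eq_mul, map_intCast]
    rw [show (-1 - 1 : ℤ) = -2 by norm_num]
    push_cast
    ring
  rw [hd, X.smear_vac, ← X.smearFun_apply, map_sub, map_smul, X.smearFun_apply, X.smearFun_apply,
    X.smear_vac] at h
  rw [h]
  abel

end VertexAlgebra

/-! ### Weights -/

theorem ceilWt_add_int (μ : ℂ) (n : ℤ) : ceilWt (μ + n) = ceilWt μ + n := by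
  simp [ceilWt, Int.ceil_add_intCast]

theorem fracWt_add_int (μ : ℂ) (n : ℤ) : fracWt (μ + n) = fracWt μ := by
  rw [fracWt, ceilWt_add_int, fracWt]
  push_cast
  ring

theorem eq_ceilWt_of_fracWt_eq_zero {μ : ℂ} (h : fracWt μ = 0) : μ = ceilWt μ := sub_eq_zero.1 h

theorem ceilWt_intCast (n : ℤ) : ceilWt n = n := by simp [ceilWt]

theorem fracWt_intCast (n : ℤ) : fracWt n = 0 := by rw [fracWt, ceilWt_intCast, sub_self]

/-- A form of the Chu–Vandermonde identity; it is the substitution rule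
`(1 - z/(1+z))^x (1+z)^N = (1+z)^{N-x}` read coefficientwise. -/
theorem sum_antidiagonal_choose_sub (x N : ℤ) (n : ℕ) :
    ∑ p ∈ Finset.HasAntidiagonal.antidiagonal n,
        (-1) ^ p.1 * Ring.choose x p.1 * Ring.choose (N - p.1) p.2 =
      Ring.choose (N - x) n := by
  have hneg : ∀ (r : ℤ) (i : ℕ), Ring.choose r i = (-1) ^ i * Ring.choose (i - 1 - r) i := by
    intro r i
    have := Ring.choose_neg (-r) i
    rw [neg_neg] at this
    rw [this, show -r + i - 1 = i - 1 - r by ring]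
    simp [Int.negOnePow_def, Units.smul_def]
  rw [hneg (N - x) n, show n - 1 - (N - x) = x + (n - 1 - N) by ring,
    Ring.add_choose_eq n (Commute.all _ _), Finset.mul_sum]
  refine Finset.sum_congr rfl fun p hp => ?_
  obtain rfl := Finset.HasAntidiagonal.mem_antidiagonal.1 hp
  rw [hneg (N - p.1) p.2, pow_add]
  push_cast
  rw [show (p.2 : ℤ) - 1 - (N - p.1) = p.1 + p.2 - 1 - N by ring]
  ring

namespace CGradedVertexAlgebra

open VertexAlgebra

variable {V : Type*} [AddCommGroup V] [Module ℂ V] (X : CGradedVertexAlgebra V)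

theorem mem_of_forall_gr {S : Submodule ℂ V} (h : ∀ μ, ∀ a ∈ X.gr μ, a ∈ S) (a : V) : a ∈ S := by
  have : ⨆ μ, X.gr μ ≤ S := iSup_le h
  rw [X.isInternal.submodule_iSup_eq_top] at this
  exact this trivial

/-- The vacuum has weight `0`: since `𝟏(-1)` is the identity, the operators `c(-1)` of the
components `c` of `𝟏` of weight `λ ≠ 0` vanish, and `c = c(-1)𝟏`. -/
theorem vac_mem_gr : X.vac ∈ X.gr 0 := by
  classical
  let _ := X.isInternal.chooseDecomposition
  have key : ∀ l : ℂ, l ≠ 0 → ((DirectSum.decompose X.gr X.vac l : X.gr l) : V) = 0 := by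
    intro l hl
    set c : ℂ → V := fun l => ((DirectSum.decompose X.gr X.vac l : X.gr l) : V) with hc
    have hop : ∀ b : V, X.mode (c l) (-1) b = 0 := by
      intro b
      refine X.mem_of_forall_gr (S := LinearMap.ker (X.mode (c l) (-1))) (fun μ b hb => ?_) b
      have hmem : ∀ ν, X.mode (c ν) (-1) b ∈ X.gr (μ + ν) := fun ν => by
        simpa using X.mode_mem ν μ (c ν) b (-1) (SetLike.coe_mem _) hb
      have hsum : b = ∑ ν ∈ (DirectSum.decompose X.gr X.vac).support, X.mode (c ν) (-1) b := by
        have h1 := X.vac_mode (-1) b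
        rw [if_pos rfl] at h1
        conv_lhs => rw [← h1, ← DirectSum.sum_support_decompose X.gr X.vac]
        simp [stateMode, map_sum, hc]
      have h2 := congrArg (fun v => ((DirectSum.decompose X.gr v (μ + l) : X.gr (μ + l)) : V)) hsum
      simp only at h2
      rw [DirectSum.decompose_of_mem_ne X.gr hb (by simpa using hl),
        DirectSum.decompose_sum, DFinsupp.finsetSum_apply, AddSubmonoidClass.coe_finsetSum] at h2
      rw [LinearMap.mem_ker]
      by_cases hl' : l ∈ (DirectSum.decompose X.gr X.vac).support
      · rw [Finset.sum_eq_single_of_mem l hl', DirectSum.decompose_of_mem_same X.gr (hmem l)] at h2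
        · exact h2.symm
        · intro ν _ hν
          exact DirectSum.decompose_of_mem_ne X.gr (hmem ν) (by simpa using hν)
      · rw [DFinsupp.notMem_support_iff] at hl'
        simp [hc, hl', stateMode]
    exact (X.mode_neg_one_vac (c l)).symm.trans (hop _)
  rw [← DirectSum.sum_support_decompose X.gr X.vac]
  refine Submodule.sum_mem _ fun l _ => ?_
  by_cases hl : l = 0
  · subst hl
    exact SetLike.coe_mem _
  · rw [key l hl]
    exact zero_mem _

theorem T_mem_gr {l : ℂ} {a : V} (ha : a ∈ X.gr l) : X.T a ∈ X.gr (l + 1) := by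
  rw [X.T_eq]
  convert X.mode_mem l 0 a X.vac (-2) ha X.vac_mem_gr using 2
  push_cast
  ring

theorem T_pow_mem_gr {l : ℂ} {a : V} (ha : a ∈ X.gr l) (i : ℕ) :
    (X.T ^ i) a ∈ X.gr (l + i) := by
  induction i with
  | zero => simpa using ha
  | succ i ih =>
    rw [pow_succ', Module.End.mul_apply, Nat.cast_succ, ← add_assoc]
    exact X.T_mem_gr ih

/-! ### Elements of `O(V)` -/

theorem circ_mem_O (a b : V) : X.circ a b ∈ X.O := Submodule.subset_span ⟨a, b, rfl⟩

theorem circ_of_mem {μ : ℂ} {a : V} (ha : a ∈ X.gr μ) (b : V) :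
    X.circ a b = X.smear (onePlusZ ^ (ceilWt μ + kron (fracWt μ) - 1) *
      zVar ^ (-(1 + kron (fracWt μ) : ℤ))) a b := by
  rw [circ, X.extendProd_of_mem _ ha, zhuKernel_eq]
  push_cast
  rfl

theorem star_of_mem {μ : ℂ} (hμ : fracWt μ = 0) {a : V} (ha : a ∈ X.gr μ) (b : V) :
    X.star a b = X.smear (onePlusZ ^ ceilWt μ * zVar ^ (-1 : ℤ)) a b := by
  rw [star, X.extendProd_of_mem _ ha, zhuKernel_eq, kron, if_pos hμ, one_smul]
  rfl

theorem star_of_mem_of_ne {μ : ℂ} (hμ : fracWt μ ≠ 0) {a : V} (ha : a ∈ X.gr μ) (b : V) :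
    X.star a b = 0 := by
  rw [star, X.extendProd_of_mem _ ha, kron, if_neg hμ, zero_smul]
  rfl

/-- The space of kernels `(1+z)^{⌈Re μ⌉+δ-1} z^{-1-δ} ℂ[z⁻¹]`, spanned by the kernel of `a ∘ b` for
`a ∈ V_μ` and those with higher pole order; here `δ = δ_{r,0}` with `r = μ - ⌈Re μ⌉`. -/
def circKernels (μ : ℂ) : Submodule ℂ (LaurentSeries ℂ) :=
  kernelSpace (ceilWt μ + kron (fracWt μ) - 1) (-(1 + kron (fracWt μ) : ℤ))

/-- The pole order in the definition of `a ∘ b` may be raised: since `Ta ∘ b ∈ O(V)`,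
integration by parts raises it by one. -/
theorem smear_mem_O {μ : ℂ} {a : V} (ha : a ∈ X.gr μ) (b : V) {f : LaurentSeries ℂ}
    (hf : f ∈ circKernels μ) : X.smear f a b ∈ X.O := by
  refine kernelSpace_le_of_monomials (S := X.O.comap (X.smearFun a b)) (fun n => ?_) hf
  change X.smear _ a b ∈ X.O
  clear hf
  induction n generalizing μ a with
  | zero =>
    rw [Nat.cast_zero, sub_zero, ← X.circ_of_mem ha]
    exact X.circ_mem_O a b
  | succ n ih =>
    have h1 := ih (X.T_mem_gr ha)
    have e1 := ceilWt_add_int μ 1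
    have e2 := fracWt_add_int μ 1
    rw [Int.cast_one] at e1 e2
    rw [e1, e2, X.smear_T] at h1
    set p := ceilWt μ + kron (fracWt μ) - 1 with hp
    set q : ℤ := -(1 + kron (fracWt μ) : ℤ) with hq
    rw [show ceilWt μ + 1 + kron (fracWt μ) - 1 = p + 1 by lia] at h1
    have hd : zDeriv (onePlusZ ^ (p + 1) * zVar ^ (q - n)) =
        ((p + 1 + (q - n) : ℤ) : ℂ) • (onePlusZ ^ p * zVar ^ (q - n)) +
          ((q - n : ℤ) : ℂ) • (onePlusZ ^ p * zVar ^ (q - (n + 1 : ℕ))) := by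
      rw [Derivation.leibniz, Derivation.leibniz_zpow, Derivation.leibniz_zpow, zDeriv_zVar,
        zDeriv_onePlusZ, add_sub_cancel_right, Nat.cast_succ, ← sub_sub,
        zpow_sub_one₀ zVar_ne_zero, zpow_add_one₀ onePlusZ_ne_zero]
      simp only [smul_eq_mul, mul_one, ← HahnSeries.C_mul_eq_smul, zsmul_eq_mul, map_intCast]
      have h3 : onePlusZ ^ p * onePlusZ * (((q - n : ℤ) : LaurentSeries ℂ) *
          (zVar ^ (q - n : ℤ) * zVar⁻¹)) = onePlusZ ^ p * ((q - n : ℤ) : LaurentSeries ℂ) *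
          zVar ^ (q - n : ℤ) * (onePlusZ * zVar⁻¹) := by ring
      rw [h3, onePlusZ_mul_inv]
      push_cast
      ring
    rw [hd, neg_mem_iff, ← X.smearFun_apply, map_add, map_smul, map_smul] at h1
    replace h1 := (Submodule.add_mem_iff_right _ (X.O.smul_mem _ (ih ha))).1 h1
    -- The coefficient `q - n = -(1 + δ + n)` of the new term is nonzero.
    exact (Submodule.smul_mem_iff _ (Int.cast_ne_zero.2 (by lia))).1 h1

/-- If `a ∈ V_μ` with `μ` not an integer, then `a = a ∘ 𝟏`. -/
theorem gr_le_O {μ : ℂ} (hμ : fracWt μ ≠ 0) : X.gr μ ≤ X.O := by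
  intro a ha
  have h := X.circ_of_mem ha X.vac
  rw [kron, if_neg hμ, Nat.cast_zero, add_zero, add_zero, X.smear_vac] at h
  rw [← h]
  exact X.circ_mem_O a _

/-- If `l` is an integer and `a ∈ V_l`, then `a ∘ 𝟏 = Ta + la`. -/
theorem T_add_smul_mem_O {l : ℤ} {a : V} (ha : a ∈ X.gr l) : X.T a + (l : ℂ) • a ∈ X.O := by
  have h := X.circ_of_mem ha X.vac
  rw [kron, if_pos (fracWt_intCast l), Nat.cast_one, ceilWt_intCast, add_sub_cancel_right,
    one_add_one_eq_two, X.smear_vac'] at h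
  rw [← h]
  exact X.circ_mem_O a _

/-- Modulo `O(V)` the operator `T` acts on each `V_{l+k}` as `-(l+k)`, hence `Tⁱ / i!` acts on `V_l`
as `(-l)(-l-1)⋯(-l-i+1) / i! = (-l choose i)`. -/
theorem mkQ_mode_vac {l : ℤ} {a : V} (ha : a ∈ X.gr l) (i : ℕ) :
    X.O.mkQ (X.mode a (-1 - i) X.vac) = ((Ring.choose (-l) i : ℤ) : ℂ) • X.O.mkQ a := by
  have h : ∀ i : ℕ, X.O.mkQ ((X.T ^ i) a) =
      ((i.factorial * Ring.choose (-l) i : ℤ) : ℂ) • X.O.mkQ a := by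
    intro i
    induction i with
    | zero => simp
    | succ i ih =>
      have h1 := X.T_pow_mem_gr ha i
      rw [show (l : ℂ) + (i : ℂ) = ((l + i : ℤ) : ℂ) by push_cast; rfl] at h1
      have h2 := X.T_add_smul_mem_O h1
      rw [← Submodule.Quotient.mk_eq_zero, ← Submodule.mkQ_apply, map_add, map_smul, ih, smul_smul,
        ← Module.End.mul_apply, ← pow_succ'] at h2
      rw [eq_neg_of_add_eq_zero_left h2, ← neg_smul]
      congr 1
      have h3 := Ring.choose_smul_choose (-l) (Nat.le_succ i)
      rw [Nat.succ_sub (le_refl i), Nat.sub_self, Ring.choose_one_right, nsmul_eq_mul,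
        Nat.choose_succ_self_right] at h3
      rw [← Int.cast_mul, ← Int.cast_neg, Nat.factorial_succ]
      congr 1
      push_cast at h3 ⊢
      linear_combination (-(i.factorial : ℤ)) * h3
  have h4 := h i
  rw [← X.factorial_smul_mode_vac, map_smul, Int.cast_mul, mul_smul, Int.cast_natCast] at h4
  exact smul_right_injective _ (Nat.cast_ne_zero.2 i.factorial_ne_zero) h4

/-- Skew-symmetry modulo `O(V)`: for integral weights
`Res_z (1+z)^{|u|} z⁻¹ Y(u,z)a ≡ Res_z (1+z)^{|a|-1} z⁻¹ Y(a,z)u`. -/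
theorem mkQ_smear_skew {l m : ℤ} {u a : V} (hu : u ∈ X.gr l) (ha : a ∈ X.gr m) :
    X.O.mkQ (X.smear (onePlusZ ^ (m - 1) * zVar ^ (-1 : ℤ)) a u) =
      X.O.mkQ (X.smear (onePlusZ ^ l * zVar ^ (-1 : ℤ)) u a) := by
  obtain ⟨J₁, hJ₁⟩ := X.exists_mode_eq_zero_nat a u
  obtain ⟨J₂, hJ₂⟩ := X.exists_mode_eq_zero_nat u a
  set J := J₁ + J₂ + 1
  rw [X.smear_eq_sum _ a u (J := J) fun n hn => hJ₁ n (by lia),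
    X.smear_eq_sum _ u a (J := J) fun n hn => hJ₂ n (by lia), map_sum, map_sum]
  -- `F j i` is the contribution of `u(j+i-1)a` to the class of `(m-1 choose j) a(j-1)u`.
  set F : ℕ → ℕ → X.A := fun j i => (((-1) ^ j * Ring.choose (m - 1) j *
    Ring.choose (l + m - 1 - j) i : ℤ) : ℂ) • X.O.mkQ (X.mode u (((j + i : ℕ) : ℤ) - 1) a) with hF
  have h1 : ∀ j ∈ Finset.range J, X.O.mkQ (((Ring.choose (m - 1) j : ℤ) : ℂ) •
      X.mode a ((j : ℤ) - 1) u) = ∑ i ∈ Finset.range (J - j), F j i := by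
    intro j hj
    have hj := Finset.mem_range.1 hj
    rw [X.mode_skew a u ((j : ℤ) - 1) (J := J - j) fun i hi => hJ₂ _ (by lia), map_smul, map_smul,
      map_sum, smul_smul, Finset.smul_sum]
    refine Finset.sum_congr rfl fun i _ => ?_
    -- The weight of `u(j-1+i)a`, on which `Tⁱ / i!` acts modulo `O(V)`.
    have hw : X.mode u ((j : ℤ) - 1 + i) a ∈ X.gr ((l + m - j - i : ℤ) : ℂ) := by
      convert X.mode_mem l m u a ((j : ℤ) - 1 + i) hu ha using 2
      push_cast
      ring
    have hc : Ring.choose (-(l + m - j - i)) i = (-1) ^ i * Ring.choose (l + m - 1 - j) i := by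
      rw [Ring.choose_neg, show l + m - j - i + i - 1 = l + m - 1 - j by ring]
      simp [Int.negOnePow_def, Units.smul_def]
    rw [map_smul, X.mkQ_mode_vac hw, hc, smul_smul, smul_smul, hF]
    simp only
    rw [show ((j + i : ℕ) : ℤ) - 1 = (j : ℤ) - 1 + i by push_cast; ring, sub_add_cancel,
      zpow_natCast]
    congr 1
    push_cast
    have : ((-1 : ℂ) ^ i) * (-1) ^ i = 1 := by rw [← mul_pow]; simp
    linear_combination (((Ring.choose (m - 1) j : ℤ) : ℂ) * (-1) ^ j *
      ((Ring.choose (l + m - 1 - j) i : ℤ) : ℂ)) * this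
  -- Collecting the terms with `j + i = n` gives the coefficient `(l choose n)`.
  rw [Finset.sum_congr rfl h1, ← Finset.sum_range_diag_flip]
  refine Finset.sum_congr rfl fun n _ => ?_
  rw [← Finset.Nat.sum_antidiagonal_eq_sum_range_succ F n, map_smul,
    show l = l + m - 1 - (m - 1) by ring, ← sum_antidiagonal_choose_sub, Int.cast_sum,
    Finset.sum_smul]
  refine Finset.sum_congr rfl fun p hp => ?_
  rw [hF]
  simp only
  rw [Finset.HasAntidiagonal.mem_antidiagonal.1 hp]

/-! ### The star product modulo `O(V)` -/

theorem fracWt_mode {μ : ℂ} (l n : ℤ) : fracWt (μ + l - n - 1) = fracWt μ := by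
  rw [← fracWt_add_int μ (l - n - 1)]
  push_cast
  ring_nf

/-- For `f ∈ (1+z)^e z^q ℂ[z⁻¹]` the `j`-th term of the commutator formula has a kernel in which the
exponent of `1+z` is lowered by `j`. This matches the weight of `a(j)b`, so that under the
conditions `he` and `hq` every term is in `O(V)`. -/
theorem smear_commutator_mem_O {l : ℤ} {μ : ℂ} {a b : V} (ha : a ∈ X.gr l) (hb : b ∈ X.gr μ)
    (c : V) {e q e' q' : ℤ} {f g : LaurentSeries ℂ} (hf : f ∈ kernelSpace e q)
    (hg : g ∈ kernelSpace e' q') (he : e + e' = ceilWt μ + l + kron (fracWt μ) - 2)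
    (hq : q + q' = -(1 + kron (fracWt μ) : ℤ)) :
    X.smear f a (X.smear g b c) - X.smear g b (X.smear f a c) ∈ X.O := by
  obtain ⟨J, hJ⟩ := X.exists_mode_eq_zero_nat a b
  rw [X.smear_commutator f g a b c hJ]
  refine Submodule.sum_mem _ fun j _ => X.smear_mem_O (X.mode_mem l μ a b j ha hb) c ?_
  have h := mul_mem_kernelSpace (hasseDeriv_mem_kernelSpace hf j) hg
  have hc : ceilWt (μ + l - (j : ℤ) - 1) = ceilWt μ + l - j - 1 := by
    have := ceilWt_add_int μ (l - j - 1)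
    rw [show ceilWt μ + l - j - 1 = ceilWt μ + (l - j - 1) by ring, ← this]
    push_cast
    ring_nf
  rw [circKernels, fracWt_mode, hc]
  convert h using 2 <;> lia

/-- For `a` of integral weight `l`, the operators `Res_z (1+z)^{l-1} P(z⁻¹) Y(a,z)` with `P` a
polynomial preserve `O(V)`. Both `a ⋆ -` and, modulo `O(V)`, `- ⋆ a` are of this form. -/
theorem smear_mem_O_of_mem_O {l : ℤ} {a : V} (ha : a ∈ X.gr l) {f : LaurentSeries ℂ}
    (hf : f ∈ kernelSpace (l - 1) 0) {u : V} (hu : u ∈ X.O) : X.smear f a u ∈ X.O := by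
  have h : ∀ μ, ∀ b ∈ X.gr μ, ∀ c, X.smear f a (X.circ b c) ∈ X.O := by
    intro μ b hb c
    rw [X.circ_of_mem hb]
    have hg := monomial_mem_kernelSpace (ceilWt μ + kron (fracWt μ) - 1)
      (-(1 + kron (fracWt μ) : ℤ))
    have h := X.smear_commutator_mem_O ha hb c hf hg (by ring) (zero_add _)
    exact (Submodule.sub_mem_iff_left _ (X.smear_mem_O hb _ hg)).1 h
  have h' : ∀ b c, X.smear f a (X.circ b c) ∈ X.O := fun b c =>
    X.mem_of_forall_gr (S := X.O.comap (X.smear f a ∘ₗ X.circ.flip c))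
      (fun μ b hb => h μ b hb c) b
  refine (Submodule.span_le (p := X.O.comap (X.smear f a))).2 ?_ hu
  rintro _ ⟨b, c, rfl⟩
  exact h' b c

theorem star_mem_O (a : V) {u : V} (hu : u ∈ X.O) : X.star a u ∈ X.O := by
  refine X.mem_of_forall_gr (S := X.O.comap (X.star.flip u)) (fun l a ha => ?_) a
  change X.star a u ∈ X.O
  by_cases hl : fracWt l = 0
  · rw [X.star_of_mem hl ha]
    have ha' : a ∈ X.gr (ceilWt l) := eq_ceilWt_of_fracWt_eq_zero hl ▸ ha
    refine X.smear_mem_O_of_mem_O ha' (kernelSpace_succ_pred_le _ _ ?_) hu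
    rw [sub_add_cancel, zero_sub]
    exact monomial_mem_kernelSpace _ _
  · rw [X.star_of_mem_of_ne hl ha]
    exact zero_mem _

/-- For `a` of integral weight, `u ⋆ a ≡ Res_z (1+z)^{|a|-1} z⁻¹ Y(a,z)u` modulo `O(V)`. -/
theorem star_sub_smear_mem_O (u : V) {m : ℤ} {a : V} (ha : a ∈ X.gr m) :
    X.star u a - X.smear (onePlusZ ^ (m - 1) * zVar ^ (-1 : ℤ)) a u ∈ X.O := by
  refine X.mem_of_forall_gr (S := X.O.comap (X.star.flip a -
    X.smear (onePlusZ ^ (m - 1) * zVar ^ (-1 : ℤ)) a)) (fun l u hu => ?_) u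
  change X.star u a - X.smear (onePlusZ ^ (m - 1) * zVar ^ (-1 : ℤ)) a u ∈ X.O
  by_cases hl : fracWt l = 0
  · rw [X.star_of_mem hl hu, ← Submodule.Quotient.mk_eq_zero, ← Submodule.mkQ_apply, map_sub,
      sub_eq_zero]
    exact (X.mkQ_smear_skew (eq_ceilWt_of_fracWt_eq_zero hl ▸ hu) ha).symm
  · obtain ⟨J, hJ⟩ := X.exists_mode_eq_zero_nat a u
    rw [X.star_of_mem_of_ne hl hu, zero_sub, neg_mem_iff,
      X.smear_eq_sum _ a u (J := J + 1) fun n hn => hJ n (by lia)]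
    refine Submodule.sum_mem _ fun j _ => Submodule.smul_mem _ _ ?_
    exact X.gr_le_O (by rwa [fracWt_mode]) (X.mode_mem m l a u _ ha hu)

theorem star_mem_O_of_left_mem {u : V} (hu : u ∈ X.O) (a : V) : X.star u a ∈ X.O := by
  refine X.mem_of_forall_gr (S := X.O.comap (X.star u)) (fun m a ha => ?_) a
  change X.star u a ∈ X.O
  by_cases hm : fracWt m = 0
  · have ha' : a ∈ X.gr (ceilWt m) := eq_ceilWt_of_fracWt_eq_zero hm ▸ ha
    exact (Submodule.sub_mem_iff_left _ (X.smear_mem_O_of_mem_O ha'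
      (kernelSpace_pred_le _ _ (monomial_mem_kernelSpace _ _)) hu)).1
      (X.star_sub_smear_mem_O u ha')
  · exact X.star_mem_O u (X.gr_le_O hm ha)

/-- Associativity modulo `O(V)`: right multiplication by `c` is `Res_z (1+z)^{|c|-1} z⁻¹ Y(c,z)`,
which commutes with left multiplication by `a` modulo `O(V)`. -/
theorem star_assoc_mem_O (a b c : V) :
    X.star (X.star a b) c - X.star a (X.star b c) ∈ X.O := by
  refine X.mem_of_forall_gr (S := X.O.comap (X.star (X.star a b) - X.star a ∘ₗ X.star b))
    (fun m c hc => ?_) c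
  change X.star (X.star a b) c - X.star a (X.star b c) ∈ X.O
  by_cases hm : fracWt m = 0
  swap
  · have hc' := X.gr_le_O hm hc
    exact sub_mem (X.star_mem_O _ hc') (X.star_mem_O _ (X.star_mem_O _ hc'))
  replace hc : c ∈ X.gr (ceilWt m) := eq_ceilWt_of_fracWt_eq_zero hm ▸ hc
  set R := X.smear (onePlusZ ^ (ceilWt m - 1) * zVar ^ (-1 : ℤ)) c with hR
  have h1 : X.star (X.star a b) c - R (X.star a b) ∈ X.O := X.star_sub_smear_mem_O _ hc
  have h2 := X.star_mem_O a (X.star_sub_smear_mem_O b hc)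
  have h3 : R (X.star a b) - X.star a (R b) ∈ X.O := by
    refine X.mem_of_forall_gr (S := X.O.comap (R ∘ₗ X.star.flip b - X.star.flip (R b)))
      (fun l a ha => ?_) a
    change R (X.star a b) - X.star a (R b) ∈ X.O
    by_cases hl : fracWt l = 0
    · rw [X.star_of_mem hl ha, X.star_of_mem hl ha]
      refine X.smear_commutator_mem_O hc ha b (monomial_mem_kernelSpace (ceilWt m - 1) (-1))
        (monomial_mem_kernelSpace (ceilWt l) (-1)) ?_ ?_ <;> rw [kron, if_pos hl]
      · push_cast
        ring
      · norm_num
    · rw [X.star_of_mem_of_ne hl ha, X.star_of_mem_of_ne hl ha, map_zero, sub_zero]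
      exact zero_mem _
  rw [map_sub] at h2
  convert sub_mem (add_mem h1 h3) h2 using 1
  abel

theorem vac_star (a : V) : X.star X.vac a = a := by
  have h0 : (0 : ℂ) = ((0 : ℤ) : ℂ) := Int.cast_zero.symm
  rw [X.star_of_mem ((congrArg fracWt h0).trans (fracWt_intCast 0)) X.vac_mem_gr, h0,
    ceilWt_intCast, zpow_zero, one_mul, zVar_zpow, X.smear_single]
  exact (X.vac_mode (-1) a).trans (if_pos rfl)

theorem star_vac_sub_mem_O (a : V) : X.star a X.vac - a ∈ X.O := by
  refine X.mem_of_forall_gr (S := X.O.comap (X.star.flip X.vac - LinearMap.id))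
    (fun l a ha => ?_) a
  change X.star a X.vac - a ∈ X.O
  by_cases hl : fracWt l = 0
  · rw [X.star_of_mem hl ha, X.smear_vac, sub_self]
    exact zero_mem _
  · rw [X.star_of_mem_of_ne hl ha, zero_sub, neg_mem_iff]
    exact X.gr_le_O hl ha

/-- The product of `A(V)` induced by the star product. -/
def mulA : X.A →ₗ[ℂ] X.A →ₗ[ℂ] X.A :=
  X.O.liftQ (X.O.liftQ (X.star.compr₂ X.O.mkQ).flip fun u hu => LinearMap.ext fun a =>
    (Submodule.Quotient.mk_eq_zero _).2 (X.star_mem_O a hu)).flip fun u hu =>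
      LinearMap.ext fun x => by
        obtain ⟨a, rfl⟩ := X.O.mkQ_surjective x
        exact (Submodule.Quotient.mk_eq_zero _).2 (X.star_mem_O_of_left_mem hu a)

theorem mulA_mkQ (a b : V) : X.mulA (X.O.mkQ a) (X.O.mkQ b) = X.O.mkQ (X.star a b) := rfl

end CGradedVertexAlgebra

end

theorem mainTheorem1 {V : Type*} [AddCommGroup V] [Module ℂ V] (X : CGradedVertexAlgebra V) :
    (∀ r : ℂ, r ≠ 0 → X.piece r ≤ X.O) ∧
    (∀ a u : V, u ∈ X.O → X.star a u ∈ X.O) ∧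
    (∀ u a : V, u ∈ X.O → X.star u a ∈ X.O) ∧
    ∃ mul : X.A →ₗ[ℂ] X.A →ₗ[ℂ] X.A,
      (∀ a b : V, mul (X.O.mkQ a) (X.O.mkQ b) = X.O.mkQ (X.star a b)) ∧
      (∀ x y z : X.A, mul (mul x y) z = mul x (mul y z)) ∧
      (∀ x : X.A, mul (X.O.mkQ X.vac) x = x ∧ mul x (X.O.mkQ X.vac) = x) := by
  refine ⟨fun r hr => iSup_le fun μ => X.gr_le_O (by rw [μ.2]; exact hr),
    fun a u hu => X.star_mem_O a hu, fun u a hu => X.star_mem_O_of_left_mem hu a,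
    X.mulA, X.mulA_mkQ, fun x y z => ?_, fun x => ⟨?_, ?_⟩⟩
  · obtain ⟨a, rfl⟩ := X.O.mkQ_surjective x
    obtain ⟨b, rfl⟩ := X.O.mkQ_surjective y
    obtain ⟨c, rfl⟩ := X.O.mkQ_surjective z
    simp only [X.mulA_mkQ]
    rw [← sub_eq_zero, ← map_sub]
    exact (Submodule.Quotient.mk_eq_zero _).2 (X.star_assoc_mem_O a b c)
  · obtain ⟨a, rfl⟩ := X.O.mkQ_surjective x
    rw [X.mulA_mkQ, X.vac_star]
  · obtain ⟨a, rfl⟩ := X.O.mkQ_surjective x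
    rw [X.mulA_mkQ, ← sub_eq_zero, ← map_sub]
    exact (Submodule.Quotient.mk_eq_zero _).2 (X.star_vac_sub_mem_O a)
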